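/- **Model.** Let $W$ (writers), $R$ (readers) and $S$ (servers) be finite sets of processes, let $V$ be a set of values with at least two elements, and let $v_0\in V$. Processes communicate by messages over asynchronous point-to-point channels, which are reliable but may reorder messages. A *three-exchange protocol* consists of arbitrary (deterministic) processes with arbitrary local states and message alphabets that communicate only as follows. 1. When a read or a write is invoked at a client (a reader or a writer), the client updates its state and sends request messages to a set of servers. 2. When a server receives a request, it updates its state, sends relay messages to a set of servers, and may send replies to clients. 3. When a server receives a relay, it updates its state and may send replies to clients (for instance because it has now received enough relays). A relay triggers no other messages. When a client receives a reply, it updates its state, sends nothing, and may complete its pending operation (a read then returns a value). So every operation, read or write, takes at most three communication exchanges: request, relay, reply. Each client invokes one operation at a time. An operation $\pi$ *precedes* $\pi'$ if the response of $\pi$ occurs before the invocation of $\pi'$. The protocol is *atomic* with initial value $v_0$ if for every finite execution in which all invoked operations are complete there is a strict partial order $\prec$ on the operations such that (P1) if $\pi$ precedes $\pi'$, then not $\pi'\prec\pi$; (P2) the writes are totally ordered by $\prec$, and every read is ordered with respect to every write; (P3) every read returns the value of the last write that is $\prec$-before it, and $v_0$ if there is no such write. The protocol *terminates with $f$ server failures*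 if in every execution in which at most $f$ servers and any set of clients crash (stop taking steps), and every message sent to a non-crashed process is eventually received, every operation invoked by a non-crashed client eventually completes. **Theorem.** Let $|W|=|R|=2$ and $|S|\ge 3$. Then no three-exchange protocol is atomic (with initial value $v_0$) and terminates with $f=1$ server failure. In other words, there is no atomic multi-writer multi-reader read/write register implementation in which all operations, reads and writes, perform three communication exchanges. -/

import Mathlib

universe u a b c d

namespace ThreeExchange

/-- A message-passing register protocol in which every operation uses at most three communication
exchanges. `W`, `R`, `S` are the sets of writers, readers and servers, `V` the set of values.

1. When an operation is invoked, the invoking client sends a request to a set of servers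
   (`wInvoke`, `rInvoke`; `none` means that nothing is sent to that server).
2. A server that receives a request sends relay messages to a set of servers
   (second component of `onRequest`).
3. Servers reply to clients, when they have received enough relays (`onRelay`), or already on a
   request (third component of `onRequest`).

There are no other messages: a relay only triggers replies, a reply triggers no message.
The state spaces, the message alphabets and the transition functions are arbitrary. -/
structure Protocol (W : Type a) (R : Type b) (S : Type c) (V : Type d) where
  WState : Type u
  RState : Type u
  SState : Type u
  Req : Type u
  Rel : Type u
  Rep : Type u
  wInit : W → WState
  rInit : R → RState
  sInit : S → SState
  /-- Writer `w` is asked to write a value. -/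
  wInvoke : W → WState → V → WState × (S → Option Req)
  /-- Reader `r` is asked to read. -/
  rInvoke : R → RState → RState × (S → Option Req)
  /-- A server receives a request from a client. -/
  onRequest : S → SState → W ⊕ R → Req → SState × (S → Option Rel) × (W ⊕ R → Option Rep)
  /-- A server receives a relay from a server. -/
  onRelay : S → SState → S → Rel → SState × (W ⊕ R → Option Rep)
  /-- A writer receives a reply from a server; `true` means that the pending write returns. -/
  wOnReply : W → WState → S → Rep → WState × Bool
  /-- A reader receives a reply from a server; `some v` means that the pending read returns `v`. -/
  rOnReply : R → RState → S → Rep → RState × Option V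

/-! ### Histories and atomicity -/

/-- Invocation and response actions at the interface of the register. -/
inductive Event (W R V : Type*) where
  | invWrite (w : W) (v : V)
  | invRead (r : R)
  | resWrite (w : W)
  | resRead (r : R) (v : V)

namespace Event

variable {W R V : Type*}

/-- The client at which an event takes place. -/
def client : Event W R V → W ⊕ R
  | invWrite w _ => Sum.inl w
  | invRead r => Sum.inr r
  | resWrite w => Sum.inl w
  | resRead r _ => Sum.inr r

def IsInv : Event W R V → Prop
  | invWrite _ _ => True
  | invRead _ => True
  | resWrite _ => False
  | resRead _ _ => False

end Event

section History

variable {W R V : Type*}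

/-- An operation of a history is identified with the position of its invocation. -/
def IsOp (h : List (Event W R V)) (i : ℕ) : Prop :=
  ∃ e, h[i]? = some e ∧ e.IsInv

/-- `i` is an operation that writes `v`. -/
def IsWriteOf (h : List (Event W R V)) (i : ℕ) (v : V) : Prop :=
  ∃ w, h[i]? = some (Event.invWrite w v)

def IsWrite (h : List (Event W R V)) (i : ℕ) : Prop :=
  ∃ v, IsWriteOf h i v

/-- The event at position `j` is the response that matches the invocation at position `i`:
it is the first event after `i` at the same client, and it is a response. -/
def RespondsAt (h : List (Event W R V)) (i j : ℕ) : Prop :=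
  i < j ∧ ∃ e e', h[i]? = some e ∧ e.IsInv ∧ h[j]? = some e' ∧ ¬ e'.IsInv ∧
    e'.client = e.client ∧
    ∀ k, i < k → k < j → ∀ e'', h[k]? = some e'' → e''.client ≠ e.client

/-- The operation `i` is a read that returns `v`. -/
def ReadReturns (h : List (Event W R V)) (i : ℕ) (v : V) : Prop :=
  ∃ j r, RespondsAt h i j ∧ h[j]? = some (Event.resRead r v)

/-- The operation `i` precedes the operation `i'`: its response is before the invocation of `i'`. -/
def Precedes (h : List (Event W R V)) (i i' : ℕ) : Prop :=
  IsOp h i' ∧ ∃ j, RespondsAt h i j ∧ j < i'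

/-- All invoked operations are complete. -/
def AllComplete (h : List (Event W R V)) : Prop :=
  ∀ i, IsOp h i → ∃ j, RespondsAt h i j

/-- The operations of the history `h` can be partially ordered by `lt` as atomicity demands,
`v₀` being the initial value of the register. -/
structure IsAtomicOrder (v₀ : V) (h : List (Event W R V)) (lt : ℕ → ℕ → Prop) : Prop where
  irrefl : ∀ i, IsOp h i → ¬ lt i i
  trans : ∀ i j k, IsOp h i → IsOp h j → IsOp h k → lt i j → lt j k → lt i k
  /-- The order does not contradict the real-time order. -/
  consistent : ∀ i j, IsOp h i → IsOp h j → Precedes h i j → ¬ lt j i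
  /-- Writes are totally ordered, and every read is ordered with respect to all writes. -/
  total : ∀ i j, IsWrite h i → IsOp h j → i ≠ j → lt i j ∨ lt j i
  /-- A read returns the value of the last write that precedes it in the order, and the initial
  value if there is none. -/
  value : ∀ i v, ReadReturns h i v →
    (∃ j, IsWriteOf h j v ∧ lt j i ∧ ∀ k, IsWrite h k → lt k i → k = j ∨ lt k j) ∨
    ((∀ k, IsWrite h k → ¬ lt k i) ∧ v = v₀)

def Atomic (v₀ : V) (h : List (Event W R V)) : Prop :=
  AllComplete h → ∃ lt : ℕ → ℕ → Prop, IsAtomicOrder v₀ h lt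

end History

/-! ### Executions -/

/-- The processes of the system. -/
inductive Proc (W R S : Type*) where
  | client (c : W ⊕ R)
  | server (s : S)

section Executions

variable {W R S V : Type*}

/-- Messages with their sender and their receiver. -/
inductive Msg (P : Protocol W R S V) where
  | req (c : W ⊕ R) (s : S) (m : P.Req)
  | rel (s t : S) (m : P.Rel)
  | rep (s : S) (c : W ⊕ R) (m : P.Rep)

/-- The receiver of a message. -/
def Msg.dest {P : Protocol W R S V} : Msg P → Proc W R S
  | .req _ s _ => .server s
  | .rel _ t _ => .server t
  | .rep _ c _ => .client c

/-- A global state: the local states, which clients have a pending operation, the messages in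
transit, and the invocations and responses so far. -/
structure Config (P : Protocol W R S V) where
  wState : W → P.WState
  rState : R → P.RState
  sState : S → P.SState
  pending : W ⊕ R → Bool
  transit : Multiset (Msg P)
  hist : List (Event W R V)

/-- The actions: invocations, the receipt of a message (with the local computation and the
sending of messages that it causes), and an idle step by which finite executions are padded. -/
inductive Action (P : Protocol W R S V) where
  | write (w : W) (v : V)
  | read (r : R)
  | deliver (m : Msg P)
  | idle

/-- The process that takes the step. -/
def Action.actor {P : Protocol W R S V} : Action P → Option (Proc W R S)
  | .write w _ => some (.client (Sum.inl w))
  | .read r => some (.client (Sum.inr r))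
  | .deliver m => some m.dest
  | .idle => none

/-- Initially nothing is pending and no message is in transit. -/
def initConfig (P : Protocol W R S V) : Config P where
  wState := P.wInit
  rState := P.rInit
  sState := P.sInit
  pending := fun _ => false
  transit := 0
  hist := []

/-- A client invokes one operation at a time, and a message is received only if it is in
transit. Messages may be received in any order. -/
def Enabled {P : Protocol W R S V} (C : Config P) : Action P → Prop
  | .write w _ => C.pending (Sum.inl w) = false
  | .read r => C.pending (Sum.inr r) = false
  | .deliver m => m ∈ C.transit
  | .idle => True

/-- The messages that arise from sending `f i`, if it is not `none`, to each `i`. -/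
def sends {ι α β : Type*} [Fintype ι] (mk : ι → α → β) (f : ι → Option α) : Multiset β :=
  (Finset.univ : Finset ι).val.filterMap fun i => (f i).map (mk i)

open Classical in
/-- The effect of an action. A response of a client that has no pending operation is ignored. -/
noncomputable def next [Fintype W] [Fintype R] [Fintype S] {P : Protocol W R S V}
    (C : Config P) : Action P → Config P
  | .write w v =>
    let o := P.wInvoke w (C.wState w) v
    { C with
      wState := Function.update C.wState w o.1
      pending := Function.update C.pending (Sum.inl w) true
      transit := C.transit + sends (fun s m => Msg.req (Sum.inl w) s m) o.2
      hist := C.hist ++ [Event.invWrite w v] }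
  | .read r =>
    let o := P.rInvoke r (C.rState r)
    { C with
      rState := Function.update C.rState r o.1
      pending := Function.update C.pending (Sum.inr r) true
      transit := C.transit + sends (fun s m => Msg.req (Sum.inr r) s m) o.2
      hist := C.hist ++ [Event.invRead r] }
  | .deliver (.req c s m) =>
    let o := P.onRequest s (C.sState s) c m
    { C with
      sState := Function.update C.sState s o.1
      transit := C.transit.erase (.req c s m) + sends (fun t m' => Msg.rel s t m') o.2.1
        + sends (fun c' m' => Msg.rep s c' m') o.2.2 }
  | .deliver (.rel s t m) =>
    let o := P.onRelay t (C.sState t) s m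
    { C with
      sState := Function.update C.sState t o.1
      transit := C.transit.erase (.rel s t m) + sends (fun c' m' => Msg.rep t c' m') o.2 }
  | .deliver (.rep s (Sum.inl w) m) =>
    let o := P.wOnReply w (C.wState w) s m
    let D : Config P :=
      { C with
        wState := Function.update C.wState w o.1
        transit := C.transit.erase (.rep s (Sum.inl w) m) }
    if o.2 = true ∧ C.pending (Sum.inl w) = true then
      { D with
        pending := Function.update C.pending (Sum.inl w) false
        hist := C.hist ++ [Event.resWrite w] }
    else D
  | .deliver (.rep s (Sum.inr r) m) =>
    let o := P.rOnReply r (C.rState r) s m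
    let D : Config P :=
      { C with
        rState := Function.update C.rState r o.1
        transit := C.transit.erase (.rep s (Sum.inr r) m) }
    match o.2, C.pending (Sum.inr r) with
    | some v, true =>
      { D with
        pending := Function.update C.pending (Sum.inr r) false
        hist := C.hist ++ [Event.resRead r v] }
    | _, _ => D
  | .idle => C

variable [Fintype W] [Fintype R] [Fintype S]

/-- The state after the first `t` actions of the sequence `act`. -/
noncomputable def stateAt (P : Protocol W R S V) (act : ℕ → Action P) : ℕ → Config P
  | 0 => initConfig P
  | t + 1 => next (stateAt P act t) (act t)

/-- `act` is the sequence of actions of a well-formed execution. -/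
def IsExecution (P : Protocol W R S V) (act : ℕ → Action P) : Prop :=
  ∀ t, Enabled (stateAt P act t) (act t)

/-- The set of crashed processes is `F`: these stop taking steps at some time, and every message
that is sent to any other process is eventually received (channels are reliable). -/
def FairWithCrashes (P : Protocol W R S V) (act : ℕ → Action P) (F : Set (Proc W R S)) : Prop :=
  (∀ p ∈ F, ∃ T, ∀ t, T ≤ t → (act t).actor ≠ some p) ∧
  ∀ t, ∀ m ∈ (stateAt P act t).transit, m.dest ∉ F → ∃ t', t ≤ t' ∧ act t' = .deliver m

/-- Safety: in every execution the operations are atomic. -/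
def IsAtomic (P : Protocol W R S V) (v₀ : V) : Prop :=
  ∀ act : ℕ → Action P, IsExecution P act → ∀ t, Atomic v₀ (stateAt P act t).hist

/-- Liveness: in every execution in which at most `f` servers and any set of clients crash, every
operation that a correct client invokes eventually completes. -/
def Terminates (P : Protocol W R S V) (f : ℕ) : Prop :=
  ∀ act : ℕ → Action P, IsExecution P act →
    ∀ F : Set (Proc W R S), FairWithCrashes P act F → {s : S | Proc.server s ∈ F}.ncard ≤ f →
      ∀ (c : W ⊕ R) (t : ℕ), Proc.client c ∉ F → (stateAt P act t).pending c = true →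
        ∃ t', t ≤ t' ∧ (stateAt P act t').pending c = false

/-- `P` implements an atomic register with initial value `v₀` and tolerates `f` server crashes. -/
def ImplementsAtomicRegister (P : Protocol W R S V) (v₀ : V) (f : ℕ) : Prop :=
  IsAtomic P v₀ ∧ Terminates P f

end Executions

end ThreeExchange

/-!
A client sends nothing in reaction to a reply. Hence, once the requests of two writes are in
transit, the servers alone determine which of the two writes is the last one, and they do so in
spite of a crash of one of them. They thus solve consensus in an asynchronous system with one
crash failure, and the valency argument of Fischer, Lynch and Paterson shows that this is
impossible. No further use is made of the number of exchanges, except that all executions of the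
servers are finite: requests trigger relays, and relays trigger no messages between servers. So an
induction on a weight of the messages in transit replaces the construction of an infinite
undecided execution.

In detail, let each of the two writers and each of the two readers perform one operation. As these
are first operations, their requests do not depend on the execution. In the server system
(`ServerSystem`, `Step`) all the requests are in transit from the start, and replies are never
received; whether a client would complete its operation with a value is a property of the replies
in transit (`Answers`), which no later step destroys. Requests of readers are received only when
both writes can complete. So each run can be realized by an execution in which both writes complete
before the reads are invoked (`Realizable`, `IsBase.run`), and atomicity forces the reads to agree
(`Atomic.eq_of_concurrent_writes`).

Both values are possible at the start (`canReturn_start`): if one write completes before the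
other is invoked, then the reads return the value of the other (`Atomic.eq_of_successive_writes`),
and in the server system, either write can be the first one. On the other hand, the value is
determined (`CanReturn.unique`). Suppose that it is determined after each step from a state `X`, and
that the steps `m` and `n` from `X` lead to different values. If they take place at different
servers, then they commute (`Step.diamond`), which is absurd. If they take place at the same server
`s`, let the other servers run until the reads can complete, as is possible because `s` might have
crashed (`IsBase.exists_answers`). This run commutes with both `m` and `n` (`Step.strip`), so the
reads return the same value after `m` and after `n`.
-/

namespace ThreeExchange

open Classical Relation

section Impossibility

variable {W : Type a} {R : Type b} {S : Type c} {V : Type d}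

/-! ### Processes as message handlers -/

/-- What a server does with a message: its new state and the messages that it sends. -/
noncomputable def serverStep [Fintype W] [Fintype R] [Fintype S] {P : Protocol.{u} W R S V} :
    Msg P → P.SState → P.SState × Multiset (Msg P)
  | .req c s m, st =>
    let o := P.onRequest s st c m
    (o.1, sends (fun t m' => Msg.rel s t m') o.2.1 + sends (fun c' m' => Msg.rep s c' m') o.2.2)
  | .rel s t m, st =>
    let o := P.onRelay t st s m
    (o.1, sends (fun c' m' => Msg.rep t c' m') o.2)
  | .rep _ _ _, st => (st, 0)

/-- What a client with a pending operation does with a reply: its new state and, possibly, the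
response. The states of writers and of readers are put into one sum type, so that both kinds of
clients can be treated alike; the mixed cases never occur. -/
def clientStep (P : Protocol.{u} W R S V) :
    (c : W ⊕ R) → P.WState ⊕ P.RState → S → P.Rep → (P.WState ⊕ P.RState) × Option (Event W R V)
  | .inl w, .inl st, s, m =>
    ((.inl (P.wOnReply w st s m).1),
      if (P.wOnReply w st s m).2 = true then some (Event.resWrite w) else none)
  | .inr r, .inr st, s, m =>
    ((.inr (P.rOnReply r st s m).1), (P.rOnReply r st s m).2.map (Event.resRead r))
  | _, st, _, _ => (st, none)

/-- The first response of a client that receives the given replies one after the other. -/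
def response (P : Protocol.{u} W R S V) (c : W ⊕ R) :
    P.WState ⊕ P.RState → List (S × P.Rep) → Option (Event W R V)
  | _, [] => none
  | st, p :: L =>
    match (clientStep P c st p.1 p.2).2 with
    | some e => some e
    | none => response P c (clientStep P c st p.1 p.2).1 L

/-- The local state of a client. -/
def Config.clientState {P : Protocol.{u} W R S V} (C : Config P) : W ⊕ R → P.WState ⊕ P.RState
  | .inl w => .inl (C.wState w)
  | .inr r => .inr (C.rState r)

/-- The initial local state of a client. -/
def clientInit (P : Protocol.{u} W R S V) : W ⊕ R → P.WState ⊕ P.RState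
  | .inl w => .inl (P.wInit w)
  | .inr r => .inr (P.rInit r)

/-- The local state of a client after the invocation of its first operation, which is, for a
writer `w`, to write `val w`. -/
def invokedState (P : Protocol.{u} W R S V) (val : W → V) : W ⊕ R → P.WState ⊕ P.RState
  | .inl w => .inl (P.wInvoke w (P.wInit w) (val w)).1
  | .inr r => .inr (P.rInvoke r (P.rInit r)).1

/-- The requests that a client sends when its first operation is invoked. -/
def requests [Fintype S] (P : Protocol.{u} W R S V) (val : W → V) :
    W ⊕ R → Multiset (Msg P)
  | .inl w => sends (fun s m => Msg.req (Sum.inl w) s m) (P.wInvoke w (P.wInit w) (val w)).2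
  | .inr r => sends (fun s m => Msg.req (Sum.inr r) s m) (P.rInvoke r (P.rInit r)).2

/-- The invocation of the first operation of a client. -/
def invocation (P : Protocol.{u} W R S V) (val : W → V) : W ⊕ R → Action P
  | .inl w => .write w (val w)
  | .inr r => .read r

/-- The event at the invocation of the first operation of a client. -/
def invocationEvent (val : W → V) : W ⊕ R → Event W R V
  | .inl w => .invWrite w (val w)
  | .inr r => .invRead r

theorem mem_sends {ι α β : Type*} [Fintype ι] {mk : ι → α → β} {f : ι → Option α} {x : β} :
    x ∈ sends mk f → ∃ i y, x = mk i y := by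
  intro h
  obtain ⟨i, _, hi⟩ := (Multiset.mem_filterMap _ _).1 h
  obtain ⟨y, _, rfl⟩ := Option.map_eq_some_iff.1 hi
  exact ⟨i, y, rfl⟩

theorem card_sends_le {ι α β : Type*} [Fintype ι] (mk : ι → α → β) (f : ι → Option α) :
    Multiset.card (sends mk f) ≤ Fintype.card ι := by
  have h : ∀ t : Multiset ι,
      Multiset.card (t.filterMap fun i => (f i).map (mk i)) ≤ Multiset.card t := fun t =>
    Quotient.inductionOn t fun l => by simpa using List.length_filterMap_le _ l
  exact h _

theorem mem_requests [Fintype S] {P : Protocol.{u} W R S V} {val : W → V} {c : W ⊕ R}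
    {m : Msg P} (h : m ∈ requests P val c) : ∃ s q, m = .req c s q := by
  cases c <;> exact mem_sends h

/-- Replies to the client `c`, given with their senders, as a multiset of messages. -/
def replies (P : Protocol.{u} W R S V) (c : W ⊕ R) (L : List (S × P.Rep)) : Multiset (Msg P) :=
  (L.map fun p => Msg.rep p.1 c p.2 : List (Msg P))

theorem dest_of_mem_replies {P : Protocol.{u} W R S V} {c : W ⊕ R}
    {L : List (S × P.Rep)} {m : Msg P} (h : m ∈ replies P c L) : m.dest = .client c := by
  obtain ⟨p, _, rfl⟩ := List.mem_map.1 (Multiset.mem_coe.1 h)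
  rfl

/-- A weight under which the receipt of a message outweighs the messages that it triggers. -/
def weight [Fintype S] {P : Protocol.{u} W R S V} : Msg P → ℕ
  | .req _ _ _ => Fintype.card S + 1
  | .rel _ _ _ => 1
  | .rep _ _ _ => 0

theorem sum_weight_sends_rep [Fintype W] [Fintype R] [Fintype S] {P : Protocol.{u} W R S V} (s : S)
    (f : W ⊕ R → Option P.Rep) :
    ((sends (fun c m => (Msg.rep s c m : Msg P)) f).map weight).sum = 0 := by
  refine Multiset.sum_eq_zero fun x hx => ?_
  obtain ⟨m, hm, rfl⟩ := Multiset.mem_map.1 hx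
  obtain ⟨_, _, rfl⟩ := mem_sends hm
  rfl

theorem sum_weight_sends_rel_le [Fintype S] {P : Protocol.{u} W R S V} (s : S)
    (f : S → Option P.Rel) :
    ((sends (fun t m => (Msg.rel s t m : Msg P)) f).map weight).sum ≤ Fintype.card S := by
  refine (Multiset.sum_le_card_nsmul _ 1 fun x hx => ?_).trans ?_
  · obtain ⟨m, hm, rfl⟩ := Multiset.mem_map.1 hx
    obtain ⟨_, _, rfl⟩ := mem_sends hm
    exact le_rfl
  · simpa using card_sends_le _ f

section Steps

variable [Fintype W] [Fintype R] [Fintype S] {P : Protocol.{u} W R S V}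

theorem req_notMem_serverStep (m : Msg P) (st : P.SState) (c : W ⊕ R) (s : S) (q : P.Req) :
    Msg.req c s q ∉ (serverStep m st).2 := by
  cases m <;> simp only [serverStep, Multiset.mem_add, not_or, Multiset.notMem_zero,
    not_false_eq_true]
  · constructor <;> intro h <;> obtain ⟨_, _, h⟩ := mem_sends h <;> cases h
  · intro h; obtain ⟨_, _, h⟩ := mem_sends h; cases h

theorem next_deliver_server (C : Config P) {m : Msg P} {s : S} (hm : m.dest = .server s) :
    next C (.deliver m) =
      { C with
        sState := Function.update C.sState s (serverStep m (C.sState s)).1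
        transit := C.transit.erase m + (serverStep m (C.sState s)).2 } := by
  cases m <;> simp only [Msg.dest, Proc.server.injEq, reduceCtorEq] at hm <;> subst hm <;>
    simp [next, serverStep, add_assoc]

theorem next_invocation (C : Config P) (val : W → V) (c : W ⊕ R)
    (hc : C.clientState c = clientInit P c) :
    (next C (invocation P val c)).sState = C.sState ∧
    (next C (invocation P val c)).clientState
      = Function.update C.clientState c (invokedState P val c) ∧
    (next C (invocation P val c)).pending = Function.update C.pending c true ∧
    (next C (invocation P val c)).transit = C.transit + requests P val c ∧
    (next C (invocation P val c)).hist = C.hist ++ [invocationEvent val c] := by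
  rcases c with w | r
  · have hc' : C.wState w = P.wInit w := by simpa [Config.clientState, clientInit] using hc
    refine ⟨rfl, ?_, rfl, ?_, rfl⟩
    · funext c
      rcases c with w' | r' <;>
        simp [next, invocation, invokedState, Config.clientState, Function.update_apply, hc']
      split_ifs <;> simp_all
    · simp [next, invocation, requests, hc']
  · have hc' : C.rState r = P.rInit r := by simpa [Config.clientState, clientInit] using hc
    refine ⟨rfl, ?_, rfl, ?_, rfl⟩
    · funext c
      rcases c with w' | r' <;>
        simp [next, invocation, invokedState, Config.clientState, Function.update_apply, hc']
      split_ifs <;> simp_all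
    · simp [next, invocation, requests, hc']

theorem next_deliver_reply (C : Config P) (s : S) (c : W ⊕ R) (m : P.Rep)
    (hc : C.pending c = true) :
    (next C (.deliver (.rep s c m))).sState = C.sState ∧
    (next C (.deliver (.rep s c m))).clientState
      = Function.update C.clientState c (clientStep P c (C.clientState c) s m).1 ∧
    (next C (.deliver (.rep s c m))).transit = C.transit.erase (.rep s c m) ∧
    (next C (.deliver (.rep s c m))).pending
      = Function.update C.pending c (clientStep P c (C.clientState c) s m).2.isNone ∧
    (next C (.deliver (.rep s c m))).hist
      = C.hist ++ (clientStep P c (C.clientState c) s m).2.toList := by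
  rcases c with w | r
  · by_cases h : (P.wOnReply w (C.wState w) s m).2 = true
    · refine ⟨?_, ?_, ?_, ?_, ?_⟩ <;>
        simp [next, clientStep, Config.clientState, hc, h]
      funext c
      rcases c with w' | r' <;>
        simp [Config.clientState, Function.update_apply]
      split_ifs <;> simp_all
    · refine ⟨?_, ?_, ?_, ?_, ?_⟩ <;>
        simp [next, clientStep, Config.clientState, hc, h]
      funext c
      rcases c with w' | r' <;>
        simp [Config.clientState, Function.update_apply]
      split_ifs <;> simp_all
  · rcases h : (P.rOnReply r (C.rState r) s m).2 with _ | v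
    · refine ⟨?_, ?_, ?_, ?_, ?_⟩ <;>
        simp [next, clientStep, Config.clientState, hc, h]
      funext c
      rcases c with w' | r' <;>
        simp [Config.clientState, Function.update_apply]
      split_ifs <;> simp_all
    · refine ⟨?_, ?_, ?_, ?_, ?_⟩ <;>
        simp [next, clientStep, Config.clientState, hc, h]
      funext c
      rcases c with w' | r' <;>
        simp [Config.clientState, Function.update_apply]
      split_ifs <;> simp_all

/-! ### Finite executions -/

/-- The configurations at the end of finite executions. -/
inductive Reachable (P : Protocol.{u} W R S V) : Config P → Prop
  | init : Reachable P (initConfig P)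
  | step {C : Config P} {x : Action P} : Reachable P C → Enabled C x → Reachable P (next C x)

theorem stateAt_congr {act act' : ℕ → Action P} {T : ℕ} (h : ∀ t < T, act t = act' t) :
    ∀ t ≤ T, stateAt P act t = stateAt P act' t := by
  intro t
  induction t with
  | zero => intro _; rfl
  | succ t ih => intro ht; simp only [stateAt]; rw [ih (by omega), h t (by omega)]

/-- A finite execution, padded by idle steps. -/
theorem Reachable.exists_execution {C : Config P} (h : Reachable P C) :
    ∃ (act : ℕ → Action P) (T : ℕ), IsExecution P act ∧ (∀ t, T ≤ t → act t = .idle) ∧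
      ∀ t, T ≤ t → stateAt P act t = C := by
  induction h with
  | init =>
    have h0 : ∀ t, stateAt P (fun _ => Action.idle) t = initConfig P := by
      intro t
      induction t with
      | zero => rfl
      | succ t ih => simp only [stateAt]; rw [ih]; rfl
    exact ⟨fun _ => .idle, 0, fun t => trivial, fun _ _ => rfl, fun t _ => h0 t⟩
  | @step C x _ hx ih =>
    obtain ⟨act, T, hex, hidle, hT⟩ := ih
    have hold : ∀ t ≤ T, stateAt P (Function.update act T x) t = stateAt P act t :=
      stateAt_congr fun t ht => Function.update_of_ne ht.ne _ _
    have hnew : ∀ t, T + 1 ≤ t → Function.update act T x t = .idle := fun t ht => by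
      rw [Function.update_of_ne (by omega), hidle t (by omega)]
    have hlast : ∀ t, T + 1 ≤ t → stateAt P (Function.update act T x) t = next C x := by
      intro t ht
      induction t, ht using Nat.le_induction with
      | base => simp [stateAt, hold T le_rfl, hT T le_rfl]
      | succ t ht ih => simp only [stateAt]; rw [ih, hnew t ht]; rfl
    refine ⟨Function.update act T x, T + 1, ?_, hnew, hlast⟩
    intro t
    rcases lt_trichotomy t T with ht | rfl | ht
    · rw [hold t ht.le, Function.update_of_ne ht.ne]; exact hex t
    · rw [hold t le_rfl, hT t le_rfl, Function.update_self]; exact hx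
    · rw [hnew t ht]; trivial

theorem Reachable.atomic {C : Config P} (h : Reachable P C) {v₀ : V} (hP : IsAtomic P v₀) :
    Atomic v₀ C.hist := by
  obtain ⟨act, T, hex, -, hT⟩ := h.exists_execution
  simpa [hT T le_rfl] using hP act hex T

theorem mem_transit_next (C : Config P) {x : Action P} {m : Msg P} (hm : m ∈ C.transit)
    (hx : x ≠ .deliver m) : m ∈ (next C x).transit := by
  cases x with
  | write w v => exact Multiset.mem_add.2 (.inl hm)
  | read r => exact Multiset.mem_add.2 (.inl hm)
  | idle => exact hm
  | deliver n =>
    have hn : m ∈ C.transit.erase n := (Multiset.mem_erase_of_ne fun h => hx (by rw [h])).2 hm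
    rcases n with ⟨c, s, q⟩ | ⟨s, t, q⟩ | ⟨s, c | r, q⟩
    · exact Multiset.mem_add.2 (.inl (Multiset.mem_add.2 (.inl hn)))
    · exact Multiset.mem_add.2 (.inl hn)
    · simp only [next]; split_ifs <;> exact hn
    · simp only [next]; split <;> exact hn

/-- If the execution stops when every message in transit is addressed to the server `s` or to a
client other than `c`, then it is fair with all these processes crashed. So `c` has no pending
operation. -/
theorem Reachable.pending_eq_false {C : Config P} (h : Reachable P C) (hP : Terminates P 1)
    {c : W ⊕ R} {s : S}
    (hC : ∀ m ∈ C.transit, m.dest = .server s ∨ ∃ c', c' ≠ c ∧ m.dest = .client c') :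
    C.pending c = false := by
  obtain ⟨act, T, hex, hidle, hT⟩ := h.exists_execution
  set F : Set (Proc W R S) := {p | p = .server s ∨ ∃ c', c' ≠ c ∧ p = .client c'} with hF
  by_contra hp
  have hfair : FairWithCrashes P act F := by
    refine ⟨fun p _ => ⟨T, fun t ht => by simp [hidle t ht, Action.actor]⟩, ?_⟩
    intro t m hm hmF
    by_contra! hnot
    -- A message that is never received is still in transit when the execution has stopped.
    have hmem : ∀ t', t ≤ t' → m ∈ (stateAt P act t').transit := by
      intro t' ht'
      induction t', ht' using Nat.le_induction with
      | base => exact hm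
      | succ t' ht' ih => exact mem_transit_next _ ih (hnot t' ht')
    have := hmem (max t T) (le_max_left _ _)
    rw [hT _ (le_max_right _ _)] at this
    exact hmF (hC m this)
  have hcard : {s' : S | Proc.server s' ∈ F}.ncard ≤ 1 := by
    have : {s' : S | Proc.server s' ∈ F} = {s} := by ext; simp [hF]
    simp [this]
  obtain ⟨t', ht', hpt⟩ := hP act hex F hfair hcard c T (by
      rintro (h | ⟨c', hc', h⟩)
      · cases h
      · cases h; exact hc' rfl)
    (by rw [hT T le_rfl]; simpa using hp)
  rw [hT t' ht'] at hpt
  exact hp hpt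

/-- `C'` arises from `C` by steps of the client `c` only, in which `c` receives replies. -/
structure OnlyClient (c : W ⊕ R) (C C' : Config P) : Prop where
  sState : C'.sState = C.sState
  client : ∀ c', c' ≠ c → C'.clientState c' = C.clientState c' ∧ C'.pending c' = C.pending c'
  transit : ∀ m : Msg P, m.dest ≠ .client c → C'.transit.count m = C.transit.count m

/-- A client with a pending operation can receive the given replies until it responds, or all of
them if it does not respond. -/
theorem Reachable.deliver_replies {c : W ⊕ R} (L : List (S × P.Rep)) :
    ∀ C : Config P, Reachable P C → C.pending c = true → replies P c L ≤ C.transit →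
    ∃ C', Reachable P C' ∧ OnlyClient c C C' ∧
      C'.hist = C.hist ++ (response P c (C.clientState c) L).toList ∧
      (response P c (C.clientState c) L = none →
        C'.pending c = true ∧ C'.transit = C.transit - replies P c L) := by
  induction L with
  | nil =>
    intro C hC hp _
    exact ⟨C, hC, ⟨rfl, fun _ _ => ⟨rfl, rfl⟩, fun _ _ => rfl⟩, by simp [response],
      fun _ => ⟨hp, by simp [replies]⟩⟩
  | cons p L ih =>
    intro C hC hp hL
    have hcons : replies P c (p :: L) = .rep p.1 c p.2 ::ₘ replies P c L := rfl
    rw [hcons] at hL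
    have hmem : Msg.rep p.1 c p.2 ∈ C.transit :=
      Multiset.mem_of_le hL (Multiset.mem_cons_self _ _)
    obtain ⟨h1, h2, h3, h4, h5⟩ := next_deliver_reply C p.1 c p.2 hp
    have hreach : Reachable P (next C (.deliver (.rep p.1 c p.2))) := hC.step hmem
    have honly : OnlyClient c C (next C (.deliver (.rep p.1 c p.2))) := by
      refine ⟨h1, fun c' hc' => ?_, fun m hm => ?_⟩
      · rw [h2, h4]; simp [hc']
      · rw [h3, Multiset.count_erase_of_ne]
        rintro rfl; exact hm rfl
    rcases hr : (clientStep P c (C.clientState c) p.1 p.2).2 with _ | e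
    · rw [hr] at h4 h5
      obtain ⟨C', hC', ho, hh, hn⟩ := ih _ hreach (by simp [h4]) (by
        rw [h3]; simpa using Multiset.erase_le_erase (.rep p.1 c p.2) hL)
      rw [h2, Function.update_self] at hh hn
      refine ⟨C', hC', ⟨ho.sState.trans h1, fun c' hc' => ?_, fun m hm => ?_⟩, ?_, ?_⟩
      · exact ⟨(ho.client c' hc').1.trans (honly.client c' hc').1,
          (ho.client c' hc').2.trans (honly.client c' hc').2⟩
      · rw [ho.transit m hm, honly.transit m hm]
      · rw [hh, h5]; simp [response, hr]
      · intro hnone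
        obtain ⟨ha, hb⟩ := hn (by simpa [response, hr] using hnone)
        refine ⟨ha, ?_⟩
        rw [hb, h3, hcons, Multiset.sub_cons]
    · rw [hr] at h4 h5
      exact ⟨_, hreach, honly, by simp [h5, response, hr], by simp [response, hr]⟩

/-! ### The system of the servers -/

/-- A state of the system of the servers. Clients take no steps in it: all their requests are in
transit from the start, and the replies to them are collected in `transit` and never received. -/
structure ServerSystem (P : Protocol.{u} W R S V) where
  sState : S → P.SState
  transit : Multiset (Msg P)

/-- The start: every client has sent the requests of its first operation. -/
noncomputable def start (P : Protocol.{u} W R S V) (val : W → V) : ServerSystem P where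
  sState := P.sInit
  transit := ∑ c, requests P val c

/-- Some of the replies in transit, received one after the other, make the client `c` respond
with `e`. -/
def Answers (val : W → V) (c : W ⊕ R) (e : Event W R V) (X : ServerSystem P) : Prop :=
  ∃ L, replies P c L ≤ X.transit ∧ response P c (invokedState P val c) L = some e

/-- Every write can complete. -/
def WritersDone (val : W → V) (X : ServerSystem P) : Prop :=
  ∀ w, ∃ e, Answers val (.inl w) e X

/-- The server `s` receives `m`. -/
noncomputable def ServerSystem.deliver (X : ServerSystem P) (s : S) (m : Msg P) :
    ServerSystem P where
  sState := Function.update X.sState s (serverStep m (X.sState s)).1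
  transit := X.transit.erase m + (serverStep m (X.sState s)).2

/-- A step: a server receives a message. Requests of readers are received only when every write
can complete, so that all the reads can be invoked after the writes. -/
def Step (val : W → V) (X : ServerSystem P) (m : Msg P) (Y : ServerSystem P) : Prop :=
  ∃ s, m.dest = .server s ∧ m ∈ X.transit ∧
    (∀ r t q, m = .req (.inr r) t q → WritersDone val X) ∧ Y = X.deliver s m

/-- `Y` is reached from `X` by receipts of messages that satisfy `p`. -/
def Run (val : W → V) (p : Msg P → Prop) : ServerSystem P → ServerSystem P → Prop :=
  ReflTransGen fun X Y => ∃ m, p m ∧ Step val X m Y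

variable {val : W → V}

theorem Run.mono {p q : Msg P → Prop} (h : ∀ m, p m → q m) {X Y : ServerSystem P}
    (hXY : Run val p X Y) : Run val q X Y := by
  induction hXY with
  | refl => exact .refl
  | tail _ hs ih =>
    obtain ⟨m, hm, hs⟩ := hs
    exact ih.tail ⟨m, h m hm, hs⟩

theorem Answers.step {c : W ⊕ R} {e : Event W R V} {X Y : ServerSystem P} {m : Msg P}
    (h : Answers val c e X) (hs : Step val X m Y) : Answers val c e Y := by
  obtain ⟨L, hL, hr⟩ := h
  obtain ⟨s, hm, -, -, rfl⟩ := hs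
  refine ⟨L, le_trans ?_ (Multiset.le_add_right _ _), hr⟩
  have hmL : m ∉ replies P c L := fun h => by
    rw [dest_of_mem_replies h] at hm; cases hm
  simpa [Multiset.erase_of_notMem hmL] using Multiset.erase_le_erase m hL

theorem Answers.run {c : W ⊕ R} {e : Event W R V} {p : Msg P → Prop} {X Y : ServerSystem P}
    (h : Answers val c e X) (hs : Run val p X Y) : Answers val c e Y := by
  induction hs with
  | refl => exact h
  | tail _ hs ih => obtain ⟨m, _, hs⟩ := hs; exact ih.step hs

theorem WritersDone.step {X Y : ServerSystem P} {m : Msg P}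
    (h : WritersDone val X) (hs : Step val X m Y) : WritersDone val Y := fun w => by
  obtain ⟨e, he⟩ := h w
  exact ⟨e, he.step hs⟩

/-- Receipts at different servers commute. -/
theorem Step.diamond {X X₁ X₂ : ServerSystem P} {m n : Msg P} (h₁ : Step val X m X₁)
    (h₂ : Step val X n X₂) (hmn : m.dest ≠ n.dest) :
    ∃ D, Step val X₁ n D ∧ Step val X₂ m D := by
  have hdone₁ : WritersDone val X → WritersDone val X₁ := fun h => h.step h₁
  have hdone₂ : WritersDone val X → WritersDone val X₂ := fun h => h.step h₂
  obtain ⟨s, hm, hmX, hmr, rfl⟩ := h₁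
  obtain ⟨t, hn, hnX, hnr, rfl⟩ := h₂
  have hst : s ≠ t := by rintro rfl; exact hmn (hm.trans hn.symm)
  have hne : m ≠ n := by rintro rfl; exact hmn rfl
  have hm' : m ∈ X.transit.erase n := (Multiset.mem_erase_of_ne hne).2 hmX
  have hn' : n ∈ X.transit.erase m := (Multiset.mem_erase_of_ne hne.symm).2 hnX
  refine ⟨(X.deliver s m).deliver t n,
    ⟨t, hn, Multiset.mem_add.2 (.inl hn'), fun r t' q h => hdone₁ (hnr r t' q h), rfl⟩,
    ⟨s, hm, Multiset.mem_add.2 (.inl hm'), fun r t' q h => hdone₂ (hmr r t' q h), ?_⟩⟩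
  simp only [ServerSystem.deliver, Function.update_of_ne hst, Function.update_of_ne hst.symm,
    ServerSystem.mk.injEq]
  refine ⟨Function.update_comm hst _ _ _, ?_⟩
  rw [Multiset.erase_add_left_pos _ hn', Multiset.erase_add_left_pos _ hm', Multiset.erase_comm,
    add_right_comm]

/-- A receipt at `s` commutes with a run in which `s` receives nothing. -/
theorem Step.strip {X X₁ Y : ServerSystem P} {m : Msg P} (h₁ : Step val X m X₁)
    (h : Run val (fun n => m.dest ≠ n.dest) X Y) :
    ∃ Y₁, Step val Y m Y₁ ∧ Run val (fun _ => True) X₁ Y₁ := by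
  induction h with
  | refl => exact ⟨X₁, h₁, .refl⟩
  | tail _ hs ih =>
    obtain ⟨Y₁, hY, hrun⟩ := ih
    obtain ⟨n, hn, hs⟩ := hs
    obtain ⟨D, hD₁, hD₂⟩ := hY.diamond hs hn
    exact ⟨D, hD₂, hrun.tail ⟨n, trivial, hD₁⟩⟩

/-- The total weight of the messages in transit; it decreases in every step. -/
def ServerSystem.weight (X : ServerSystem P) : ℕ := (X.transit.map ThreeExchange.weight).sum

theorem Step.weight_lt {X Y : ServerSystem P} {m : Msg P} (h : Step val X m Y) :
    Y.weight < X.weight := by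
  obtain ⟨s, hm, hmX, -, rfl⟩ := h
  have hX : X.weight = ThreeExchange.weight m +
      ((X.transit.erase m).map ThreeExchange.weight).sum := by
    rw [ServerSystem.weight, ← Multiset.cons_erase hmX]; simp
  have hout : ((serverStep m (X.sState s)).2.map ThreeExchange.weight).sum <
      ThreeExchange.weight m := by
    cases m with
    | req c s' q =>
      simp only [serverStep, Multiset.map_add, Multiset.sum_add, sum_weight_sends_rep]
      exact Nat.lt_succ_of_le (sum_weight_sends_rel_le _ _)
    | rel s' t q =>
      simp only [serverStep, sum_weight_sends_rep]
      exact Nat.one_pos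
    | rep => cases hm
  rw [hX]
  simp only [ServerSystem.weight, ServerSystem.deliver, Multiset.map_add, Multiset.sum_add]
  omega

theorem exists_maximal_run (p : Msg P → Prop) (X : ServerSystem P) :
    ∃ Y, Run val p X Y ∧ ∀ m Z, p m → ¬ Step val Y m Z := by
  induction h : X.weight using Nat.strong_induction_on generalizing X with
  | _ n ih =>
    by_cases hX : ∀ m Z, p m → ¬ Step val X m Z
    · exact ⟨X, .refl, hX⟩
    · push Not at hX
      obtain ⟨m, Z, hm, hZ⟩ := hX
      obtain ⟨Y, hY, hmax⟩ := ih _ (h ▸ hZ.weight_lt) Z rfl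
      exact ⟨Y, .head ⟨m, hm, hZ⟩ hY, hmax⟩

/-! ### Realizing runs of the server system by executions -/

/-- The configuration `C` realizes the state `X` of the server system: the clients in `I` have
invoked their first operation, those in `T` have responded too, and the history is `H`. The
requests of the other clients, and replies to the clients in `T`, are in transit in `X` only. -/
structure Realizes (val : W → V) (C : Config P) (X : ServerSystem P) (I T : Finset (W ⊕ R))
    (H : List (Event W R V)) : Prop where
  reachable : Reachable P C
  sState : C.sState = X.sState
  hist : C.hist = H
  fresh : ∀ c, c ∉ I → C.clientState c = clientInit P c ∧ C.pending c = false
  waiting : ∀ c ∈ I, c ∉ T → C.clientState c = invokedState P val c ∧ C.pending c = true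
  transit : ∀ m : Msg P, (∀ c ∈ T, m.dest ≠ .client c) →
    C.transit.count m + (∑ c ∈ Iᶜ, requests P val c).count m = X.transit.count m
  noRequest : ∀ c s q, c ∉ I → Msg.req c s q ∉ C.transit

/-- Some configuration realizes the state `X`. -/
def Realizable (val : W → V) (X : ServerSystem P) (I T : Finset (W ⊕ R))
    (H : List (Event W R V)) : Prop :=
  ∃ C, Realizes val C X I T H

theorem realizable_start : Realizable val (start P val) ∅ ∅ [] := by
  refine ⟨initConfig P, .init, rfl, rfl, fun c _ => ⟨by cases c <;> rfl, rfl⟩, by simp, ?_, ?_⟩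
  · simp [initConfig, start]
  · simp [initConfig]

theorem Realizable.invoke {X : ServerSystem P} {I T : Finset (W ⊕ R)} {H : List (Event W R V)}
    (h : Realizable val X I T H) {c : W ⊕ R} (hc : c ∉ I) (hcT : c ∉ T) :
    Realizable val X (insert c I) T (H ++ [invocationEvent val c]) := by
  obtain ⟨C, h⟩ := h
  obtain ⟨h1, h2, h3, h4, h5⟩ := next_invocation C val c (h.fresh c hc).1
  refine ⟨next C (invocation P val c), h.reachable.step ?_, h1.trans h.sState, by rw [h5, h.hist],
    ?_, ?_, ?_, ?_⟩
  · rcases c with w | r <;> exact (h.fresh _ hc).2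
  · intro c' hc'
    rw [Finset.mem_insert, not_or] at hc'
    rw [h2, h3, Function.update_of_ne hc'.1, Function.update_of_ne hc'.1]
    exact h.fresh c' hc'.2
  · intro c' hc' hT
    rw [h2, h3]
    by_cases hcc : c' = c
    · subst hcc; simp
    · rw [Function.update_of_ne hcc, Function.update_of_ne hcc]
      exact h.waiting c' (Finset.mem_of_mem_insert_of_ne hc' hcc) hT
  · intro m hm
    rw [← h.transit m hm, h4, Finset.compl_insert,
      ← Finset.add_sum_erase Iᶜ (requests P val) (Finset.mem_compl.2 hc), Multiset.count_add,
      Multiset.count_add, add_assoc]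
  · intro c' s q hc' hmem
    rw [Finset.mem_insert, not_or] at hc'
    rw [h4, Multiset.mem_add] at hmem
    rcases hmem with hmem | hmem
    · exact h.noRequest c' s q hc'.2 hmem
    · obtain ⟨s', q', he⟩ := mem_requests hmem
      cases he
      exact hc'.1 rfl

theorem count_sum_requests {I : Finset (W ⊕ R)} {m : Msg P}
    (hm : ∀ c s q, m = .req c s q → c ∈ I) : (∑ c ∈ Iᶜ, requests P val c).count m = 0 := by
  rw [Multiset.count_eq_zero, Multiset.mem_sum]
  rintro ⟨c, hc, hmem⟩
  obtain ⟨s, q, rfl⟩ := mem_requests hmem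
  exact Finset.mem_compl.1 hc (hm c s q rfl)

theorem Realizable.step {X Y : ServerSystem P} {I T : Finset (W ⊕ R)} {H : List (Event W R V)}
    (h : Realizable val X I T H) {m : Msg P} (hs : Step val X m Y)
    (hm : ∀ c s q, m = .req c s q → c ∈ I) : Realizable val Y I T H := by
  obtain ⟨C, h⟩ := h
  obtain ⟨s, hms, hmX, -, rfl⟩ := hs
  have hmC : m ∈ C.transit := by
    have := h.transit m (fun c _ => by rw [hms]; rintro ⟨⟩)
    rw [count_sum_requests hm, add_zero] at this
    rwa [← Multiset.count_pos, this, Multiset.count_pos]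
  have hnext := next_deliver_server C hms
  refine ⟨next C (.deliver m), h.reachable.step hmC, ?_, ?_, ?_, ?_, ?_, ?_⟩ <;> rw [hnext]
  · simp [ServerSystem.deliver, h.sState]
  · exact h.hist
  · exact fun c hc => h.fresh c hc
  · exact fun c hc hT => h.waiting c hc hT
  · intro n hn
    have hcount := h.transit n hn
    simp only [ServerSystem.deliver, Multiset.count_add, h.sState]
    by_cases hnm : n = m
    · subst hnm
      have := Multiset.count_pos.2 hmC
      rw [Multiset.count_erase_self, Multiset.count_erase_self]
      omega
    · rw [Multiset.count_erase_of_ne hnm, Multiset.count_erase_of_ne hnm]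
      omega
  · intro c t q hc hmem
    rcases Multiset.mem_add.1 hmem with hmem | hmem
    · exact h.noRequest c t q hc (Multiset.mem_of_mem_erase hmem)
    · exact req_notMem_serverStep _ _ _ _ _ hmem

theorem Realizable.run {X Y : ServerSystem P} {I T : Finset (W ⊕ R)} {H : List (Event W R V)}
    (h : Realizable val X I T H) {p : Msg P → Prop} (hs : Run val p X Y)
    (hp : ∀ c s q, p (.req c s q) → c ∈ I) : Realizable val Y I T H := by
  induction hs with
  | refl => exact h
  | tail _ hs ih =>
    obtain ⟨m, hm, hs⟩ := hs
    exact ih.step hs fun c s q hmq => hp c s q (hmq ▸ hm)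

theorem Realizable.complete {X : ServerSystem P} {I T : Finset (W ⊕ R)} {H : List (Event W R V)}
    (h : Realizable val X I T H) {c : W ⊕ R} {e : Event W R V} (hc : c ∈ I) (hcT : c ∉ T)
    (he : Answers val c e X) : Realizable val X I (insert c T) (H ++ [e]) := by
  obtain ⟨C, h⟩ := h
  obtain ⟨L, hL, hr⟩ := he
  obtain ⟨hst, hp⟩ := h.waiting c hc hcT
  have hLC : replies P c L ≤ C.transit := by
    rw [Multiset.le_iff_count]
    intro m
    by_cases hmL : m ∈ replies P c L
    · have hd := dest_of_mem_replies hmL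
      have := h.transit m (fun c' hc' => by rw [hd]; rintro ⟨⟩; exact hcT hc')
      rw [count_sum_requests (by rintro c s q rfl; cases hd), add_zero] at this
      rw [this]
      exact Multiset.le_iff_count.1 hL m
    · rw [Multiset.count_eq_zero.2 hmL]; exact Nat.zero_le _
  obtain ⟨C', hreach, honly, hhist, -⟩ := Reachable.deliver_replies L C h.reachable hp hLC
  refine ⟨C', hreach, honly.sState.trans h.sState, ?_, ?_, ?_, ?_, ?_⟩
  · rw [hhist, hst, hr, h.hist]; rfl
  · intro c' hc'
    have hne : c' ≠ c := by rintro rfl; exact hc' hc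
    rw [(honly.client c' hne).1, (honly.client c' hne).2]
    exact h.fresh c' hc'
  · intro c' hc' hT
    rw [Finset.mem_insert, not_or] at hT
    rw [(honly.client c' hT.1).1, (honly.client c' hT.1).2]
    exact h.waiting c' hc' hT.2
  · intro m hm
    rw [honly.transit m (hm c (Finset.mem_insert_self _ _))]
    exact h.transit m fun c' hc' => hm c' (Finset.mem_insert_of_mem hc')
  · intro c' s q hc' hmem
    refine h.noRequest c' s q hc' ?_
    rwa [← Multiset.count_pos, ← honly.transit _ (by rintro ⟨⟩), Multiset.count_pos]

/-- If no server but `s` can take a step without a further invocation, then every client with a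
pending operation has enough replies to complete it: otherwise `s` and all other clients could
crash, and the operation would never complete. -/
theorem Realizable.exists_answers {X : ServerSystem P} {I T : Finset (W ⊕ R)}
    {H : List (Event W R V)} (h : Realizable val X I T H) (hP : Terminates P 1) {c : W ⊕ R}
    (hc : c ∈ I) (hcT : c ∉ T) {s : S}
    (hI : ∀ r, .inr r ∈ I → WritersDone val X)
    (hX : ∀ m Z, (∀ c s q, m = .req c s q → c ∈ I) → m.dest ≠ .server s → ¬ Step val X m Z) :
    ∃ e, Answers val c e X := by
  obtain ⟨C, h⟩ := h
  have hlist : ∀ l : List (Msg P), (∀ m ∈ l, m.dest = .client c) →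
      ∃ L : List (S × P.Rep), L.map (fun p => Msg.rep p.1 c p.2) = l := by
    intro l
    induction l with
    | nil => exact fun _ => ⟨[], rfl⟩
    | cons m l ih =>
      intro hl
      obtain ⟨L, rfl⟩ := ih fun m hm => hl m (List.mem_cons_of_mem _ hm)
      have hm := hl m List.mem_cons_self
      rcases m with _ | _ | ⟨s', c', q⟩
      · cases hm
      · cases hm
      · cases hm; exact ⟨(s', q) :: L, rfl⟩
  -- `c` receives all the replies to it that are in transit. If it does not respond, then only
  -- messages to `s` and to other clients remain.
  obtain ⟨L, hL⟩ := hlist (C.transit.filter fun m => m.dest = .client c).toList (by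
    intro m hm; exact (Multiset.mem_filter.1 (Multiset.mem_toList.1 hm)).2)
  have hrep : replies P c L = C.transit.filter fun m => m.dest = .client c := by
    rw [replies, hL, Multiset.coe_toList]
  obtain ⟨hst, hp⟩ := h.waiting c hc hcT
  have hLC : replies P c L ≤ C.transit := hrep ▸ Multiset.filter_le _ _
  obtain ⟨C', hreach, -, -, hnone⟩ := Reachable.deliver_replies L C h.reachable hp hLC
  rw [hst] at hnone
  rcases hr : response P c (invokedState P val c) L with _ | e
  · obtain ⟨hp', ht'⟩ := hnone hr
    have hfalse : C'.pending c = false := by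
      refine hreach.pending_eq_false hP (s := s) fun m hm => ?_
      have hmC : m ∈ C.transit := Multiset.mem_of_le (by rw [ht']; exact tsub_le_self) hm
      rcases hd : m.dest with c' | s'
      · refine .inr ⟨c', ?_, rfl⟩
        rintro rfl
        rw [ht', hrep, Multiset.sub_filter_eq_filter_not, Multiset.mem_filter] at hm
        exact hm.2 hd
      · left
        by_contra hne
        have hmI : ∀ c s q, m = .req c s q → c ∈ I := by
          rintro c s q rfl
          by_contra hcI
          exact h.noRequest c s q hcI hmC
        have hcount := h.transit m (fun c _ => by rw [hd]; rintro ⟨⟩)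
        have hmX : m ∈ X.transit := by
          have := Multiset.count_pos.2 hmC
          rw [← Multiset.count_pos]; omega
        refine hX m _ hmI (by rw [hd]; exact hne) ⟨s', hd, hmX, ?_, rfl⟩
        rintro r t q rfl
        exact hI r (hmI _ t q rfl)
    rw [hfalse] at hp'
    cases hp'
  · refine ⟨e, L, ?_, hr⟩
    rw [Multiset.le_iff_count]
    intro m
    by_cases hmL : m ∈ replies P c L
    · have hd := dest_of_mem_replies hmL
      have := h.transit m (fun c' hc' => by rw [hd]; rintro ⟨⟩; exact hcT hc')
      have := Multiset.le_iff_count.1 hLC m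
      omega
    · rw [Multiset.count_eq_zero.2 hmL]; exact Nat.zero_le _

end Steps

/-! ### The histories -/

/-- A read that is not ordered before the later of the two writes returns its value. -/
theorem IsAtomicOrder.value_eq {v₀ : V} {h : List (Event W R V)} {lt : ℕ → ℕ → Prop}
    (ho : IsAtomicOrder v₀ h lt) {i j k : ℕ} {v x : V}
    (hwrites : ∀ l, IsWrite h l → l = i ∨ l = j) (hi : IsWrite h i) (hj : IsWriteOf h j v)
    (hij : lt i j) (hk : ReadReturns h k x) (hkj : ¬ lt k j) (hkop : IsOp h k) (hne : k ≠ j) :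
    x = v := by
  have hop : ∀ l, IsWrite h l → IsOp h l := fun l ⟨v, w, hl⟩ => ⟨_, hl, trivial⟩
  have hjk : lt j k := (ho.total j k ⟨v, hj⟩ hkop hne.symm).resolve_right hkj
  rcases ho.value k x hk with ⟨l, hl, -, hlast⟩ | ⟨hnone, -⟩
  · rcases hwrites l ⟨x, hl⟩ with rfl | rfl
    · rcases hlast j ⟨v, hj⟩ hjk with rfl | hji
      · exact absurd hij (ho.irrefl _ (hop _ hi))
      · exact absurd (ho.trans _ _ _ (hop _ hi) (hop _ ⟨v, hj⟩) (hop _ hi) hij hji)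
          (ho.irrefl _ (hop _ hi))
    · obtain ⟨w, hw⟩ := hl
      obtain ⟨w', hw'⟩ := hj
      rw [hw] at hw'
      cases hw'
      rfl
  · exact absurd hjk (hnone j ⟨v, hj⟩)

theorem respondsAt_of_getElem? {h : List (Event W R V)} {i j : ℕ} {e e' : Event W R V}
    (hij : i < j) (hi : h[i]? = some e) (he : e.IsInv) (hj : h[j]? = some e') (he' : ¬ e'.IsInv)
    (hc : e'.client = e.client)
    (hk : ∀ k, i < k → k < j → ∀ e'', h[k]? = some e'' → e''.client ≠ e.client) :
    RespondsAt h i j :=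
  ⟨hij, e, e', hi, he, hj, he', hc, hk⟩

/-- Two reads that follow two concurrent writes return the same value. -/
theorem Atomic.eq_of_concurrent_writes {v₀ v₁ v₂ x y : V} {w₁ w₂ : W} {r₁ r₂ : R} (hw : w₁ ≠ w₂)
    (hr : r₁ ≠ r₂)
    (h : Atomic v₀ [.invWrite w₁ v₁, .invWrite w₂ v₂, .resWrite w₁, .resWrite w₂, .invRead r₁,
      .invRead r₂, .resRead r₁ x, .resRead r₂ y]) : x = y := by
  set l : List (Event W R V) := [.invWrite w₁ v₁, .invWrite w₂ v₂, .resWrite w₁, .resWrite w₂,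
    .invRead r₁, .invRead r₂, .resRead r₁ x, .resRead r₂ y] with hl
  have hops : ∀ i, IsOp l i → i = 0 ∨ i = 1 ∨ i = 4 ∨ i = 5 := by
    rintro i ⟨e, hi, he⟩
    have : i < 8 := (List.getElem?_eq_some_iff.1 hi).1
    interval_cases i <;> simp [hl] at hi <;> subst hi <;> simp_all [Event.IsInv]
  have hwrites : ∀ i, IsWrite l i → i = 0 ∨ i = 1 := by
    rintro i ⟨v, w, hi⟩
    have : i < 8 := (List.getElem?_eq_some_iff.1 hi).1
    interval_cases i <;> simp [hl] at hi <;> simp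
  have h0 : RespondsAt l 0 2 := respondsAt_of_getElem? (by norm_num) rfl trivial rfl id rfl
    (by intro k _ _ e he; interval_cases k; cases he; simpa [Event.client] using hw.symm)
  have h1 : RespondsAt l 1 3 := respondsAt_of_getElem? (by norm_num) rfl trivial rfl id rfl
    (by intro k _ _ e he; interval_cases k; cases he; simpa [Event.client] using hw)
  have h4 : RespondsAt l 4 6 := respondsAt_of_getElem? (by norm_num) rfl trivial rfl id rfl
    (by intro k _ _ e he; interval_cases k; cases he; simpa [Event.client] using hr.symm)
  have h5 : RespondsAt l 5 7 := respondsAt_of_getElem? (by norm_num) rfl trivial rfl id rfl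
    (by intro k _ _ e he; interval_cases k; cases he; simpa [Event.client] using hr)
  obtain ⟨lt, ho⟩ := h fun i hi => by
    rcases hops i hi with rfl | rfl | rfl | rfl
    exacts [⟨_, h0⟩, ⟨_, h1⟩, ⟨_, h4⟩, ⟨_, h5⟩]
  have o0 : IsOp l 0 := ⟨_, rfl, trivial⟩
  have o1 : IsOp l 1 := ⟨_, rfl, trivial⟩
  have o4 : IsOp l 4 := ⟨_, rfl, trivial⟩
  have o5 : IsOp l 5 := ⟨_, rfl, trivial⟩
  have w0 : IsWriteOf l 0 v₁ := ⟨w₁, rfl⟩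
  have w1 : IsWriteOf l 1 v₂ := ⟨w₂, rfl⟩
  have n40 : ¬ lt 4 0 := ho.consistent 0 4 o0 o4 ⟨o4, 2, h0, by norm_num⟩
  have n50 : ¬ lt 5 0 := ho.consistent 0 5 o0 o5 ⟨o5, 2, h0, by norm_num⟩
  have n41 : ¬ lt 4 1 := ho.consistent 1 4 o1 o4 ⟨o4, 3, h1, by norm_num⟩
  have n51 : ¬ lt 5 1 := ho.consistent 1 5 o1 o5 ⟨o5, 3, h1, by norm_num⟩
  have r4 : ReadReturns l 4 x := ⟨6, r₁, h4, rfl⟩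
  have r5 : ReadReturns l 5 y := ⟨7, r₂, h5, rfl⟩
  -- Both reads return the value of the write that is the later one in the order.
  rcases ho.total 0 1 ⟨_, w0⟩ o1 (by norm_num) with h01 | h10
  · rw [ho.value_eq hwrites ⟨_, w0⟩ w1 h01 r4 n41 o4 (by norm_num),
      ho.value_eq hwrites ⟨_, w0⟩ w1 h01 r5 n51 o5 (by norm_num)]
  · rw [ho.value_eq (fun i hi => (hwrites i hi).symm) ⟨_, w1⟩ w0 h10 r4 n40 o4 (by norm_num),
      ho.value_eq (fun i hi => (hwrites i hi).symm) ⟨_, w1⟩ w0 h10 r5 n50 o5 (by norm_num)]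

/-- A read that follows two successive writes returns the value of the second one. -/
theorem Atomic.eq_of_successive_writes {v₀ v₁ v₂ x y : V} {w₁ w₂ : W} {r₁ r₂ : R} (hr : r₁ ≠ r₂)
    (h : Atomic v₀ [.invWrite w₁ v₁, .resWrite w₁, .invWrite w₂ v₂, .resWrite w₂, .invRead r₁,
      .invRead r₂, .resRead r₁ x, .resRead r₂ y]) : x = v₂ := by
  set l : List (Event W R V) := [.invWrite w₁ v₁, .resWrite w₁, .invWrite w₂ v₂, .resWrite w₂,
    .invRead r₁, .invRead r₂, .resRead r₁ x, .resRead r₂ y] with hl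
  have hops : ∀ i, IsOp l i → i = 0 ∨ i = 2 ∨ i = 4 ∨ i = 5 := by
    rintro i ⟨e, hi, he⟩
    have : i < 8 := (List.getElem?_eq_some_iff.1 hi).1
    interval_cases i <;> simp [hl] at hi <;> subst hi <;> simp_all [Event.IsInv]
  have hwrites : ∀ i, IsWrite l i → i = 0 ∨ i = 2 := by
    rintro i ⟨v, w, hi⟩
    have : i < 8 := (List.getElem?_eq_some_iff.1 hi).1
    interval_cases i <;> simp [hl] at hi <;> simp
  have h0 : RespondsAt l 0 1 := respondsAt_of_getElem? (by norm_num) rfl trivial rfl id rfl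
    (by intro k _ _; omega)
  have h2 : RespondsAt l 2 3 := respondsAt_of_getElem? (by norm_num) rfl trivial rfl id rfl
    (by intro k _ _; omega)
  have h4 : RespondsAt l 4 6 := respondsAt_of_getElem? (by norm_num) rfl trivial rfl id rfl
    (by intro k _ _ e he; interval_cases k; cases he; simpa [Event.client] using hr.symm)
  have h5 : RespondsAt l 5 7 := respondsAt_of_getElem? (by norm_num) rfl trivial rfl id rfl
    (by intro k _ _ e he; interval_cases k; cases he; simpa [Event.client] using hr)
  obtain ⟨lt, ho⟩ := h fun i hi => by
    rcases hops i hi with rfl | rfl | rfl | rfl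
    exacts [⟨_, h0⟩, ⟨_, h2⟩, ⟨_, h4⟩, ⟨_, h5⟩]
  have o0 : IsOp l 0 := ⟨_, rfl, trivial⟩
  have o2 : IsOp l 2 := ⟨_, rfl, trivial⟩
  have o4 : IsOp l 4 := ⟨_, rfl, trivial⟩
  have w0 : IsWriteOf l 0 v₁ := ⟨w₁, rfl⟩
  have w2 : IsWriteOf l 2 v₂ := ⟨w₂, rfl⟩
  have n20 : ¬ lt 2 0 := ho.consistent 0 2 o0 o2 ⟨o2, 1, h0, by norm_num⟩
  have n42 : ¬ lt 4 2 := ho.consistent 2 4 o2 o4 ⟨o4, 3, h2, by norm_num⟩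
  have h02 : lt 0 2 := (ho.total 0 2 ⟨_, w0⟩ o2 (by norm_num)).resolve_right n20
  exact ho.value_eq hwrites ⟨_, w0⟩ w2 h02 ⟨6, r₁, h4, rfl⟩ n42 o4 (by norm_num)

/-! ### The form of the responses -/

theorem clientStep_inl_eq_some {P : Protocol.{u} W R S V} {w : W} {st : P.WState ⊕ P.RState}
    {s : S} {q : P.Rep} {e : Event W R V} (h : (clientStep P (.inl w) st s q).2 = some e) :
    e = .resWrite w := by
  rcases st with st | st <;> simp only [clientStep] at h
  · split_ifs at h
    exact (Option.some.inj h).symm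
  · cases h

theorem clientStep_inr_eq_some {P : Protocol.{u} W R S V} {r : R} {st : P.WState ⊕ P.RState}
    {s : S} {q : P.Rep} {e : Event W R V} (h : (clientStep P (.inr r) st s q).2 = some e) :
    ∃ v, e = .resRead r v := by
  rcases st with st | st <;> simp only [clientStep] at h
  · cases h
  · obtain ⟨v, -, rfl⟩ := Option.map_eq_some_iff.1 h
    exact ⟨v, rfl⟩

theorem exists_clientStep_of_response {P : Protocol.{u} W R S V} {c : W ⊕ R} {e : Event W R V}
    {L : List (S × P.Rep)} : ∀ {st : P.WState ⊕ P.RState}, response P c st L = some e →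
      ∃ st' s q, (clientStep P c st' s q).2 = some e := by
  induction L with
  | nil => intro st h; cases h
  | cons p L ih =>
    intro st h
    rw [response] at h
    rcases hp : (clientStep P c st p.1 p.2).2 with _ | e' <;> rw [hp] at h
    · exact ih h
    · exact ⟨st, p.1, p.2, hp.trans h⟩

theorem Answers.eq_resWrite {P : Protocol.{u} W R S V} {val : W → V} {w : W} {e : Event W R V}
    {X : ServerSystem P} (h : Answers val (.inl w) e X) : e = .resWrite w := by
  obtain ⟨L, -, h⟩ := h
  obtain ⟨_, _, _, h⟩ := exists_clientStep_of_response h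
  exact clientStep_inl_eq_some h

theorem Answers.exists_eq_resRead {P : Protocol.{u} W R S V} {val : W → V} {r : R} {e : Event W R V}
    {X : ServerSystem P} (h : Answers val (.inr r) e X) : ∃ v, e = .resRead r v := by
  obtain ⟨L, -, h⟩ := h
  obtain ⟨_, _, _, h⟩ := exists_clientStep_of_response h
  exact clientStep_inr_eq_some h

section Steps

variable [Fintype W] [Fintype R] [Fintype S] {P : Protocol.{u} W R S V} {val : W → V}

/-! ### Runs with two writers and two readers -/

/-- Starting from `X₀`, where both writes are invoked and the clients in `T` have responded, all
runs can be realized with the reads invoked after both writes, the history up to the invocation of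
the reads being `H`. -/
structure IsBase (val : W → V) (w₁ w₂ : W) (X₀ : ServerSystem P) (T : Finset (W ⊕ R))
    (H₀ H : List (Event W R V)) : Prop where
  realizable : Realizable val X₀ {.inl w₂, .inl w₁} T H₀
  done : ∀ w, .inl w ∈ T → ∃ e, Answers val (.inl w) e X₀
  complete : ∀ X : ServerSystem P, WritersDone val X →
    Realizable val X {.inl w₂, .inl w₁} T H₀ →
    Realizable val X {.inl w₂, .inl w₁} {.inl w₂, .inl w₁} H

section Base

variable {w₁ w₂ : W} {r₁ r₂ : R} {X₀ : ServerSystem P} {T : Finset (W ⊕ R)}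
  {H₀ H : List (Event W R V)}

theorem Realizable.invoke_readers (hr : r₁ ≠ r₂) {X : ServerSystem P}
    (h : Realizable val X {.inl w₂, .inl w₁} {.inl w₂, .inl w₁} H) :
    Realizable val X (insert (.inr r₂) (insert (.inr r₁) {.inl w₂, .inl w₁}))
      {.inl w₂, .inl w₁} (H ++ [.invRead r₁] ++ [.invRead r₂]) :=
  (h.invoke (c := .inr r₁) (by simp) (by simp)).invoke (c := .inr r₂) (by simp [hr.symm]) (by simp)

/-- Every run can be realized: before both writes can complete, no request of a reader is received,
so the reads need not be invoked yet. As soon as both writes can complete, they do, and the reads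
are invoked. -/
theorem IsBase.run (hb : IsBase val w₁ w₂ X₀ T H₀ H) (hW : ∀ w, w = w₁ ∨ w = w₂) (hr : r₁ ≠ r₂)
    (hR : ∀ r, r = r₁ ∨ r = r₂) {X : ServerSystem P} (hX : Run val (fun _ => True) X₀ X) :
    (¬ WritersDone val X → Realizable val X {.inl w₂, .inl w₁} T H₀) ∧
    (WritersDone val X → Realizable val X (insert (.inr r₂) (insert (.inr r₁) {.inl w₂, .inl w₁}))
      {.inl w₂, .inl w₁} (H ++ [.invRead r₁] ++ [.invRead r₂])) := by
  induction hX with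
  | refl =>
    exact ⟨fun _ => hb.realizable, fun hd => (hb.complete _ hd hb.realizable).invoke_readers hr⟩
  | @tail X Y _ hs ih =>
    obtain ⟨m, -, hs⟩ := hs
    by_cases hd : WritersDone val X
    · refine ⟨fun h => absurd (hd.step hs) h, fun _ => (ih.2 hd).step hs ?_⟩
      rintro (w | r) s q -
      · rcases hW w with rfl | rfl <;> simp
      · rcases hR r with rfl | rfl <;> simp
    · have hY : Realizable val Y {.inl w₂, .inl w₁} T H₀ := by
        refine (ih.1 hd).step hs ?_
        rintro (w | r) s q hm
        · rcases hW w with rfl | rfl <;> simp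
        · obtain ⟨_, _, _, hguard, _⟩ := hs
          exact absurd (hguard r s q hm) hd
      exact ⟨fun _ => hY, fun hd' => (hb.complete _ hd' hY).invoke_readers hr⟩

/-- Without any step of the server `s`, every operation can complete. -/
theorem IsBase.exists_answers (hb : IsBase val w₁ w₂ X₀ T H₀ H) (hP : Terminates P 1)
    (hW : ∀ w, w = w₁ ∨ w = w₂) (hr : r₁ ≠ r₂) (hR : ∀ r, r = r₁ ∨ r = r₂) {X : ServerSystem P}
    (hX : Run val (fun _ => True) X₀ X) (s : S) :
    ∃ Y, Run val (fun m => .server s ≠ m.dest) X Y ∧ WritersDone val Y ∧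
      ∃ x y, Answers val (.inr r₁) (.resRead r₁ x) Y ∧ Answers val (.inr r₂) (.resRead r₂ y) Y := by
  obtain ⟨Y, hXY, hmax⟩ := exists_maximal_run (val := val) (fun m => .server s ≠ m.dest) X
  have hY : Run val (fun _ => True) X₀ Y := hX.trans (hXY.mono fun _ _ => trivial)
  obtain ⟨h₁, h₂⟩ := hb.run hW hr hR hY
  -- If some write could not complete at `Y`, then the reads would not be invoked in the execution that
  -- realizes `Y`, and nothing would be left for the servers other than `s` to receive in it.
  have hd : WritersDone val Y := by
    by_contra hd
    refine hd fun w => ?_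
    by_cases hwT : .inl w ∈ T
    · obtain ⟨e, he⟩ := hb.done w hwT
      exact ⟨e, he.run hY⟩
    · refine (h₁ hd).exists_answers hP ?_ hwT (s := s) (by simp) fun m Z _ hm => hmax m Z hm.symm
      rcases hW w with rfl | rfl <;> simp
  have hread : ∀ r, ∃ v, Answers val (.inr r) (.resRead r v) Y := by
    intro r
    obtain ⟨e, he⟩ := (h₂ hd).exists_answers hP (c := .inr r)
      (by rcases hR r with rfl | rfl <;> simp) (by simp) (s := s) (fun _ _ => hd)
      fun m Z _ hm => hmax m Z hm.symm
    obtain ⟨v, rfl⟩ := he.exists_eq_resRead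
    exact ⟨v, he⟩
  obtain ⟨x, hx⟩ := hread r₁
  obtain ⟨y, hy⟩ := hread r₂
  exact ⟨Y, hXY, hd, x, y, hx, hy⟩

/-- The history in which both reads are invoked after the writes, and then complete, is atomic. -/
theorem IsBase.atomic (hb : IsBase val w₁ w₂ X₀ T H₀ H) {v₀ : V} (hP : IsAtomic P v₀)
    (hW : ∀ w, w = w₁ ∨ w = w₂) (hr : r₁ ≠ r₂) (hR : ∀ r, r = r₁ ∨ r = r₂) {X : ServerSystem P}
    (hX : Run val (fun _ => True) X₀ X) (hd : WritersDone val X) {x y : V}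
    (hx : Answers val (.inr r₁) (.resRead r₁ x) X) (hy : Answers val (.inr r₂) (.resRead r₂ y) X) :
    Atomic v₀ (H ++ [.invRead r₁] ++ [.invRead r₂] ++ [.resRead r₁ x] ++ [.resRead r₂ y]) := by
  obtain ⟨C, hC⟩ := (((hb.run hW hr hR hX).2 hd).complete (by simp) (by simp) hx).complete
    (by simp) (by simp [hr.symm]) hy
  exact hC.hist ▸ hC.reachable.atomic hP

end Base

/-- At the start, the two writes can be invoked concurrently. -/
theorem isBase_start {w₁ w₂ : W} (hw : w₁ ≠ w₂) :
    IsBase val w₁ w₂ (start P val) ∅ [.invWrite w₁ (val w₁), .invWrite w₂ (val w₂)]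
      [.invWrite w₁ (val w₁), .invWrite w₂ (val w₂), .resWrite w₁, .resWrite w₂] where
  realizable := (realizable_start.invoke (c := .inl w₁) (by simp) (by simp)).invoke
    (c := .inl w₂) (by simp [hw.symm]) (by simp)
  done := by simp
  complete X hd h := by
    obtain ⟨e₁, he₁⟩ := hd w₁
    obtain ⟨e₂, he₂⟩ := hd w₂
    obtain rfl := he₁.eq_resWrite
    obtain rfl := he₂.eq_resWrite
    exact (h.complete (by simp) (by simp) he₁).complete (by simp) (by simp [hw.symm]) he₂

/-- The first write can complete before the second one is invoked. -/
theorem exists_isBase_successive (hP : Terminates P 1) (s : S) {w₁ w₂ : W} (hw : w₁ ≠ w₂) :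
    ∃ X₀, Run val (fun _ => True) (start P val) X₀ ∧
      IsBase val w₁ w₂ X₀ {.inl w₁}
        [.invWrite w₁ (val w₁), .resWrite w₁, .invWrite w₂ (val w₂)]
        [.invWrite w₁ (val w₁), .resWrite w₁, .invWrite w₂ (val w₂), .resWrite w₂] := by
  have h₀ : Realizable val (start P val) {.inl w₁} ∅ [.invWrite w₁ (val w₁)] :=
    realizable_start.invoke (c := .inl w₁) (by simp) (by simp)
  -- Run the servers without the requests of the other clients, until the first write can complete.
  obtain ⟨X, hX, hmax⟩ := exists_maximal_run (val := val)
    (fun m => ∀ c s q, m = .req c s q → c ∈ ({.inl w₁} : Finset (W ⊕ R))) (start P val)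
  have h₁ : Realizable val X {.inl w₁} ∅ [.invWrite w₁ (val w₁)] :=
    h₀.run hX fun c s q h => h c s q rfl
  obtain ⟨e, he⟩ := h₁.exists_answers hP (c := .inl w₁) (by simp) (by simp) (s := s) (by simp)
    fun m Z hm _ => hmax m Z hm
  obtain rfl := he.eq_resWrite
  refine ⟨X, hX.mono fun _ _ => trivial, ?_, ?_, ?_⟩
  · exact (h₁.complete (by simp) (by simp) he).invoke (c := .inl w₂) (by simp [hw.symm])
      (by simp [hw.symm])
  · intro w hwT
    obtain rfl : w = w₁ := by simpa using hwT
    exact ⟨_, he⟩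
  · intro Y hd h
    obtain ⟨e₂, he₂⟩ := hd w₂
    obtain rfl := he₂.eq_resWrite
    exact h.complete (by simp) (by simp [hw.symm]) he₂

/-! ### Valency -/

/-- From `X` it is possible that a read that follows both writes returns `x`. -/
def CanReturn (val : W → V) (X : ServerSystem P) (x : V) : Prop :=
  ∃ Y, Run val (fun _ => True) X Y ∧ WritersDone val Y ∧ ∃ r, Answers val (.inr r) (.resRead r x) Y

/-- The value of the reads is determined from the start. By induction on the weight, all the
successors of `X` may be assumed to determine the value. If they do not all determine the same
one, this is because of two receipts at one server, as receipts at different servers commute. But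
the reads can complete while this server takes no step. -/
theorem CanReturn.unique {v₀ : V} (hA : IsAtomic P v₀) (hP : Terminates P 1) (s₀ : S) {w₁ w₂ : W}
    (hw : w₁ ≠ w₂) (hW : ∀ w, w = w₁ ∨ w = w₂) {r₁ r₂ : R} (hr : r₁ ≠ r₂)
    (hR : ∀ r, r = r₁ ∨ r = r₂) {X : ServerSystem P}
    (hX : Run val (fun _ => True) (start P val) X) {x y : V} (hx : CanReturn val X x)
    (hy : CanReturn val X y) : x = y := by
  have hb := isBase_start (P := P) (val := val) hw
  induction h : X.weight using Nat.strong_induction_on generalizing X x y with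
  | _ n ih =>
    -- Any server may crash at `X`, and then both reads can still complete with one value `z`.
    have hdecided : ∀ (s : S), ∃ Y z, Run val (fun m => .server s ≠ m.dest) X Y ∧
        WritersDone val Y ∧ Answers val (.inr r₁) (.resRead r₁ z) Y ∧
        ∀ r v, Answers val (.inr r) (.resRead r v) Y → v = z := by
      intro s
      obtain ⟨Y, hXY, hd, z, z', hz, hz'⟩ := hb.exists_answers hP hW hr hR hX s
      have hagree : ∀ {u u'}, Answers val (.inr r₁) (.resRead r₁ u) Y →
          Answers val (.inr r₂) (.resRead r₂ u') Y → u = u' := fun hu hu' =>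
        (hb.atomic hA hW hr hR (hX.trans (hXY.mono fun _ _ => trivial)) hd
          hu hu').eq_of_concurrent_writes hw hr
      refine ⟨Y, z, hXY, hd, hz, fun r v hv => ?_⟩
      rcases hR r with rfl | rfl
      · rw [hagree hv hz', hagree hz hz']
      · exact (hagree hz hv).symm
    -- A value that both reads can be made to return after either of two steps identifies `x`
    -- and `y`.
    have hcommon : ∀ {m n X₁ X₂ z}, Step val X m X₁ → Step val X n X₂ → CanReturn val X₁ x →
        CanReturn val X₂ y → CanReturn val X₁ z → CanReturn val X₂ z → x = y := by
      intro m n X₁ X₂ z h₁ h₂ hx hy hz₁ hz₂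
      rw [ih _ (h ▸ h₁.weight_lt) (hX.tail ⟨m, trivial, h₁⟩) hx hz₁ rfl,
        ih _ (h ▸ h₂.weight_lt) (hX.tail ⟨n, trivial, h₂⟩) hy hz₂ rfl]
    obtain ⟨Yx, hXx, hdx, rx, hrx⟩ := id hx
    obtain ⟨Yy, hXy, hdy, ry, hry⟩ := id hy
    rcases ReflTransGen.cases_head hXx with rfl | ⟨X₁, ⟨m, -, hm⟩, hrun₁⟩ <;>
      rcases ReflTransGen.cases_head hXy with rfl | ⟨X₂, ⟨n, -, hn⟩, hrun₂⟩
    -- Both values can be returned at `X` itself, hence at one later state at which the reads agree.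
    · obtain ⟨Y, z, hY, -, -, huniq⟩ := hdecided s₀
      rw [huniq rx x (hrx.run hY), huniq ry y (hry.run hY)]
    -- If `x` can be returned at `X` itself, then also after the first step of the run to `y`.
    · exact ih _ (h ▸ hn.weight_lt) (hX.tail ⟨n, trivial, hn⟩)
        ⟨X₂, .refl, hdx.step hn, rx, hrx.step hn⟩ ⟨Yy, hrun₂, hdy, ry, hry⟩ rfl
    · exact ih _ (h ▸ hm.weight_lt) (hX.tail ⟨m, trivial, hm⟩) ⟨Yx, hrun₁, hdx, rx, hrx⟩
        ⟨X₁, .refl, hdy.step hm, ry, hry.step hm⟩ rfl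
    · have hx₁ : CanReturn val X₁ x := ⟨Yx, hrun₁, hdx, rx, hrx⟩
      have hy₂ : CanReturn val X₂ y := ⟨Yy, hrun₂, hdy, ry, hry⟩
      by_cases hmn : m.dest = n.dest
      · obtain ⟨s, hs, -⟩ := id hm
        obtain ⟨Y, z, hY, hd, hz, -⟩ := hdecided s
        have hafter : ∀ {k X'}, k.dest = .server s → Step val X k X' → CanReturn val X' z := by
          intro k X' hk hstep
          obtain ⟨Y', hYY', hrun⟩ := hstep.strip (hk ▸ hY)
          exact ⟨Y', hrun, hd.step hYY', r₁, hz.step hYY'⟩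
        exact hcommon hm hn hx₁ hy₂ (hafter hs hm) (hafter (hmn ▸ hs) hn)
      · obtain ⟨D, hD₁, hD₂⟩ := hm.diamond hn hmn
        obtain ⟨Y, hDY, hd, z, -, hz, -⟩ := hb.exists_answers hP hW hr hR
          ((hX.tail ⟨m, trivial, hm⟩).tail ⟨n, trivial, hD₁⟩) s₀
        have hrun := hDY.mono (q := fun _ => True) fun _ _ => trivial
        exact hcommon hm hn hx₁ hy₂ ⟨Y, hrun.head ⟨n, trivial, hD₁⟩, hd, r₁, hz⟩
          ⟨Y, hrun.head ⟨m, trivial, hD₂⟩, hd, r₁, hz⟩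

/-- If the other write completes before that of `w₂` is invoked, then the reads return the value
of `w₂`. -/
theorem canReturn_start {v₀ : V} (hA : IsAtomic P v₀) (hP : Terminates P 1) (s₀ : S) {w₁ w₂ : W}
    (hw : w₁ ≠ w₂) (hW : ∀ w, w = w₁ ∨ w = w₂) {r₁ r₂ : R} (hr : r₁ ≠ r₂)
    (hR : ∀ r, r = r₁ ∨ r = r₂) : CanReturn val (start P val) (val w₂) := by
  obtain ⟨X₀, hX₀, hb⟩ := exists_isBase_successive (val := val) hP s₀ hw
  obtain ⟨Y, hY, hd, x, y, hx, hy⟩ := hb.exists_answers hP hW hr hR .refl s₀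
  have hrun := hY.mono (q := fun _ => True) fun _ _ => trivial
  obtain rfl := (hb.atomic hA hW hr hR hrun hd hx hy).eq_of_successive_writes hr
  exact ⟨Y, hX₀.trans hrun, hd, r₁, hx⟩

end Steps

theorem exists_pair_of_card_eq_two {α : Type*} [Fintype α] (h : Fintype.card α = 2) :
    ∃ x y : α, x ≠ y ∧ ∀ z, z = x ∨ z = y := by
  obtain ⟨x, y, hxy, huniv⟩ := Finset.card_eq_two.1 (Finset.card_univ.trans h)
  exact ⟨x, y, hxy, fun z => by simpa [huniv] using Finset.mem_univ z⟩

end Impossibility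

end ThreeExchange

theorem mainTheorem1 {W : Type a} {R : Type b} {S : Type c} {V : Type d}
    [Fintype W] [Fintype R] [Fintype S] [Nontrivial V]
    (hW : Fintype.card W = 2) (hR : Fintype.card R = 2) (hS : 3 ≤ Fintype.card S) (v₀ : V) :
    ¬ ∃ P : ThreeExchange.Protocol.{u, a, b, c, d} W R S V,
      ThreeExchange.ImplementsAtomicRegister P v₀ 1 := by
  rintro ⟨P, hA, hP⟩
  obtain ⟨w₁, w₂, hw, hW⟩ := ThreeExchange.exists_pair_of_card_eq_two hW
  obtain ⟨r₁, r₂, hr, hR⟩ := ThreeExchange.exists_pair_of_card_eq_two hR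
  obtain ⟨s₀⟩ : Nonempty S := Fintype.card_pos_iff.1 (by omega)
  obtain ⟨v₁, v₂, hv⟩ := exists_pair_ne V
  classical
  have h₂ := ThreeExchange.canReturn_start (val := fun w => if w = w₁ then v₁ else v₂) hA hP s₀
    hw hW hr hR
  have h₁ := ThreeExchange.canReturn_start (val := fun w => if w = w₁ then v₁ else v₂) hA hP s₀
    hw.symm (fun w => (hW w).symm) hr hR
  have := ThreeExchange.CanReturn.unique hA hP s₀ hw hW hr hR .refl h₁ h₂
  simp [hw.symm] at this
  exact hv this
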